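/- Equip $\mathbb{C}^n$ with the Euclidean norm, put $\langle Ax,x\rangle = x^*Ax$ and $d(x,y)=\|xx^*-yy^*\|_F$ (Frobenius norm), and write $x\sim y$ if $x=cy$ for some $c\in\mathbb{C}$ with $|c|=1$. For a real-valued $C^2$ function $f$ on $\mathbb{C}^n=\mathbb{R}^{2n}$ let $\nabla f$ and $\nabla^2 f$ be its real gradient and Hessian; for $\beta,\zeta,\gamma>0$, $f$ is called $(\beta,\zeta,\gamma)$-strict saddle if for every $x\in\mathbb{C}^n$ at least one of the following holds: (i) $\|\nabla f(x)\|\ge\beta$; (ii) $\langle\nabla^2 f(x)v,v\rangle\le-\zeta$ for some unit vector $v\in\mathbb{C}^n$; (iii) $d(x,w)\le\gamma$ for some $w$ with $\nabla f(w)=0$ and $\nabla^2 f(w)\succeq 0$. A family $A_1,\dots,A_m$ of random Hermitian $n\times n$ matrices is called complex Gaussian if all the entries on and above the diagonals of the $A_k$ are independent, the diagonal entries are real $\mathcal{N}(0,1)$, and the entries above the diagonal are $\mathcal{N}(0,\tfrac12)+\mathsf{i}\,\mathcal{N}(0,\tfrac12)$ with independent real and imaginary parts. **Theorem 2.** For every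 $\xi\in(0,1)$ there are constants $C,\beta,\zeta,\gamma>0$, depending only on $\xi$, such that the following holds for all $n$, all $m>Cn$ and all $z\in\mathbb{C}^n$. Let $A_1,\dots,A_m$ be complex Gaussian Hermitian random $n\times n$ matrices, let $c_i=\langle A_iz,z\rangle$, and let $$f(x)=\frac1m\sum_{i=1}^m\bigl|\langle A_ix,x\rangle-c_i\bigr|^2,\qquad x\in\mathbb{C}^n .$$ Then with probability at least $1-\xi$: 1. $f$ is $(\beta,\zeta,\gamma)$-strict saddle, and 2. every local minimum $w$ of $f$, and more generally every $w$ with $\nabla f(w)=0$ and $\nabla^2f(w)\succeq0$, satisfies $d(w,z)=0$, that is, $w\sim z$. -/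

import Mathlib

open MeasureTheory ProbabilityTheory
open scoped NNReal ENNReal Matrix ComplexConjugate

noncomputable section

/-- The quadratic measurement `⟨A x, x⟩ = x* A x`. -/
def quadForm {n : ℕ} (A : Matrix (Fin n) (Fin n) ℂ) (x : EuclideanSpace ℂ (Fin n)) : ℂ :=
  ∑ i, (A *ᵥ x.ofLp) i * conj (x i)

/-- The `ℓ₂`-loss `f(x) = (1/m) ∑ₖ |⟨Aₖ x, x⟩ - cₖ|²`. -/
def l2Loss {m n : ℕ} (A : Fin m → Matrix (Fin n) (Fin n) ℂ) (c : Fin m → ℂ)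
    (x : EuclideanSpace ℂ (Fin n)) : ℝ :=
  (1 / (m : ℝ)) * ∑ k, ‖quadForm (A k) x - c k‖ ^ 2

section Frobenius
attribute [local instance] Matrix.frobeniusNormedAddCommGroup

/-- The distance `d(x, y) = ‖x x* - y y*‖_F` (Frobenius norm). -/
def outerDist {n : ℕ} (x y : EuclideanSpace ℂ (Fin n)) : ℝ :=
  ‖Matrix.vecMulVec x.ofLp (star x.ofLp) - Matrix.vecMulVec y.ofLp (star y.ofLp)‖

end Frobenius

/-- `x ∼ y`: the vectors agree up to a global phase. -/
def PhaseEquiv {n : ℕ} (x y : EuclideanSpace ℂ (Fin n)) : Prop :=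
  ∃ c : ℂ, ‖c‖ = 1 ∧ x = c • y

/-- The quadratic form `⟨∇²f(x) v, v⟩` of the Hessian of a real-valued function on a real inner
product space. On `ℂⁿ` it is used with the underlying real structure (`ℂⁿ = ℝ²ⁿ`), where it is
also the value of the Wirtinger Hessian at the vector `(v, v̄)`. -/
def hessianForm {E : Type*} [NormedAddCommGroup E] [InnerProductSpace ℝ E]
    (f : E → ℝ) (x v : E) : ℝ :=
  fderiv ℝ (fderiv ℝ f) x v v

/-- `∇f(w) = 0` and `∇²f(w) ⪰ 0`. -/
def IsSecondOrderMin {E : Type*} [NormedAddCommGroup E] [InnerProductSpace ℝ E] [CompleteSpace E]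
    (f : E → ℝ) (w : E) : Prop :=
  gradient f w = 0 ∧ ∀ v : E, 0 ≤ hessianForm f w v

/-- `f` is `(β, ζ, γ)`-strict saddle. The function is required to be `C²` in the real sense, so
that its gradient and Hessian are the genuine ones. The direction of negative curvature is a unit
vector, so that the bound `-ζ` has a meaning that does not depend on the scale of the direction. -/
structure IsStrictSaddle {n : ℕ} (β ζ γ : ℝ) (f : EuclideanSpace ℂ (Fin n) → ℝ) : Prop where
  contDiff : ContDiff ℝ 2 f
  alternative : ∀ x : EuclideanSpace ℂ (Fin n),
    β ≤ ‖gradient f x‖ ∨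
    (∃ v : EuclideanSpace ℂ (Fin n), ‖v‖ = 1 ∧ hessianForm f x v ≤ -ζ) ∨
    (∃ w : EuclideanSpace ℂ (Fin n), IsSecondOrderMin f w ∧ outerDist x w ≤ γ)

/-- `A₁, …, Aₘ` are independent complex Hermitian Gaussian random `n × n` matrices: the entries on
and above the diagonal of all the matrices are independent, the diagonal entries are real standard
Gaussian, the entries above the diagonal are standard complex Gaussian (independent real and
imaginary parts of law `N(0, 1/2)`), and the remaining entries are given by Hermitian symmetry. -/
structure IsHermitianGaussian {Ω : Type*} [MeasurableSpace Ω] (μ : Measure Ω) {m n : ℕ}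
    (A : Fin m → Ω → Matrix (Fin n) (Fin n) ℂ) : Prop where
  measurable : ∀ k i j, Measurable fun ω => A k ω i j
  hermitian : ∀ k ω, (A k ω).IsHermitian
  indep : iIndepFun (fun (p : Fin m × {q : Fin n × Fin n // q.1 ≤ q.2}) (ω : Ω) =>
    A p.1 ω p.2.1.1 p.2.1.2) μ
  law_diag : ∀ k i,
    μ.map (fun ω => A k ω i i) = (gaussianReal 0 1).map (fun t : ℝ => (t : ℂ))
  law_upper : ∀ k i j, i < j →
    μ.map (fun ω => A k ω i j) =
      ((gaussianReal 0 (1 / 2)).prod (gaussianReal 0 (1 / 2))).map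
        (fun p : ℝ × ℝ => (p.1 : ℂ) + (p.2 : ℂ) * Complex.I)

end

/-! Let `y = c • z` be a phase-rotated copy of `z`, `u = x + y`, `v = x - y`, and let `b k` be the
real bilinear form of `A k`. The residuals are `b k u v`, and the Hessian of the loss at `(v, v)`
minus four times its derivative along `v` is exactly the mean of `2 * b k v v ^ 2 - 6 * b k u v ^ 2`
(`hessianForm_sub_four_mul_fderiv`). For Gaussian matrices `b k u v` is centred Gaussian with
variance `symOuterSq u v`, the squared Frobenius norm of `(u v* + v u*) / 2`. Chi-square
concentration and a union bound over pairs in a net make the means of `b k u v ^ 2` close to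
`symOuterSq u v` for all `u`, `v` at once (`exists_restricted_isometry`); this event does not
involve `z`. If the phase makes `⟨x, y⟩` real and nonnegative, then `‖v‖ ≤ ‖u‖` and `symOuterSq u v`
is at least half of `D ^ 2`, where `D = ‖u‖ * ‖v‖` dominates `d(x, z)`. The mean above is then at
most `-D ^ 2 / 2`, so away from the orbit of `z` either the gradient is large or `v` is a direction
of negative curvature. At a second-order critical point this forces `D = 0`. -/

/-! ### Calculus of least squares losses of quadratic measurements. -/

section QuadraticLoss

variable {E : Type*} [NormedAddCommGroup E] [InnerProductSpace ℝ E] {ι : Type*} [Fintype ι]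

/-- The least squares loss `x ↦ a ∑ₖ (bₖ(x, x) - cₖ)²` of a family of quadratic measurements. -/
noncomputable def quadLoss (a : ℝ) (b : ι → E →L[ℝ] E →L[ℝ] ℝ) (c : ι → ℝ) (x : E) : ℝ :=
  a * ∑ k, (b k x x - c k) ^ 2

variable {a : ℝ} {b : ι → E →L[ℝ] E →L[ℝ] ℝ} {c : ι → ℝ}

theorem contDiff_quadLoss : ContDiff ℝ 2 (quadLoss a b c) := by
  unfold quadLoss
  fun_prop

theorem hasFDerivAt_apply_self {B : E →L[ℝ] E →L[ℝ] ℝ} (hB : ∀ u v, B u v = B v u) (x : E) :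
    HasFDerivAt (fun y => B y y) ((2 : ℝ) • B x) x := by
  refine ((B.hasFDerivAt (x := x)).clm_apply (hasFDerivAt_id x)).congr_fderiv ?_
  ext v
  simp [hB v x, two_mul]

theorem hasFDerivAt_quadLoss (hb : ∀ k u v, b k u v = b k v u) (x : E) :
    HasFDerivAt (quadLoss a b c) (∑ k, (4 * a * (b k x x - c k)) • b k x) x := by
  unfold quadLoss
  have h : ∀ k ∈ Finset.univ, HasFDerivAt (fun y => (b k y y - c k) ^ 2)
      ((2 * (b k x x - c k)) • (2 : ℝ) • b k x) x := fun k _ => by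
    simpa using ((hasFDerivAt_apply_self (hb k) x).sub_const (c k)).pow 2
  refine ((HasFDerivAt.fun_sum h).const_mul a).congr_fderiv ?_
  rw [Finset.smul_sum]
  refine Finset.sum_congr rfl fun k _ => ?_
  rw [smul_smul, smul_smul]
  congr 1
  ring

theorem fderiv_quadLoss (hb : ∀ k u v, b k u v = b k v u) :
    fderiv ℝ (quadLoss a b c) = fun x => ∑ k, (4 * a * (b k x x - c k)) • b k x :=
  funext fun x => (hasFDerivAt_quadLoss hb x).fderiv

theorem hessianForm_quadLoss (hb : ∀ k u v, b k u v = b k v u) (x v : E) :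
    hessianForm (quadLoss a b c) x v =
      a * ∑ k, (8 * b k x v ^ 2 + 4 * (b k x x - c k) * b k v v) := by
  have h : ∀ k ∈ Finset.univ, HasFDerivAt (fun y => (4 * a * (b k y y - c k)) • b k y)
      ((4 * a * (b k x x - c k)) • b k + ((4 * a) • (2 : ℝ) • b k x).smulRight (b k x)) x :=
    fun k _ => ((((hasFDerivAt_apply_self (hb k) x).sub_const (c k)).const_mul (4 * a)).smul
      (b k).hasFDerivAt)
  rw [hessianForm, fderiv_quadLoss hb, (HasFDerivAt.fun_sum h).fderiv]
  simp only [sum_apply, add_apply,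
    smul_apply, ContinuousLinearMap.smulRight_apply, smul_eq_mul,
    Finset.mul_sum]
  exact Finset.sum_congr rfl fun k _ => by ring

/-- The Hessian and the gradient in the direction `x - y` of a point `y` of zero loss. -/
theorem hessianForm_sub_four_mul_fderiv (hb : ∀ k u v, b k u v = b k v u) {x y : E}
    (hy : ∀ k, b k y y = c k) :
    hessianForm (quadLoss a b c) x (x - y) - 4 * fderiv ℝ (quadLoss a b c) x (x - y) =
      a * ∑ k, (2 * b k (x - y) (x - y) ^ 2 - 6 * b k (x + y) (x - y) ^ 2) := by
  -- With `r = b k (x + y) (x - y)` the residual and `q = b k (x - y) (x - y)`, one has `2 * b k x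
  -- (x - y) = r + q`. The Hessian term is `2r² + 8rq + 2q²` and the gradient term is `2r² + 2rq`;
  -- the factor `4` is the one that cancels `rq`.
  rw [hessianForm_quadLoss hb, fderiv_quadLoss hb]
  simp only [sum_apply, smul_apply, smul_eq_mul,
    Finset.mul_sum]
  rw [← Finset.sum_sub_distrib]
  refine Finset.sum_congr rfl fun k _ => ?_
  simp only [map_sub, map_add, sub_apply, add_apply,
    hb k y x, ← hy k]
  ring

theorem quadLoss_add_smul (hb : ∀ k u v, b k u v = b k v u) (w v : E) (t : ℝ) :
    quadLoss a b c (w + t • v) = quadLoss a b c w + t * fderiv ℝ (quadLoss a b c) w v +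
      t ^ 2 * (hessianForm (quadLoss a b c) w v / 2 + t * (a * ∑ k, 4 * b k w v * b k v v) +
        t ^ 2 * (a * ∑ k, b k v v ^ 2)) := by
  rw [hessianForm_quadLoss hb, fderiv_quadLoss hb]
  simp only [quadLoss, sum_apply, smul_apply, smul_eq_mul,
    Finset.mul_sum, Finset.sum_div]
  simp only [← Finset.sum_add_distrib, mul_add, Finset.mul_sum]
  refine Finset.sum_congr rfl fun k _ => ?_
  simp only [map_add, map_smul, add_apply, smul_apply,
    smul_eq_mul, hb k v w]
  ring

theorem gradient_eq_zero_iff [CompleteSpace E] {f : E → ℝ} {x : E} :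
    gradient f x = 0 ↔ fderiv ℝ f x = 0 := by
  simp [gradient]

/-- Along a line through `w` the loss is a quartic polynomial in `t`. Without its linear term, its
increment is `t ^ 2 * p t`, so minimality gives `0 ≤ p t` near `0`, and `p 0` is half the Hessian
form. -/
theorem isSecondOrderMin_quadLoss_of_isLocalMin [CompleteSpace E]
    (hb : ∀ k u v, b k u v = b k v u) {w : E} (hw : IsLocalMin (quadLoss a b c) w) :
    IsSecondOrderMin (quadLoss a b c) w := by
  refine ⟨gradient_eq_zero_iff.2 hw.fderiv_eq_zero, fun v => ?_⟩
  set p : ℝ → ℝ := fun t => hessianForm (quadLoss a b c) w v / 2 +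
    t * (a * ∑ k, 4 * b k w v * b k v v) + t ^ 2 * (a * ∑ k, b k v v ^ 2) with hp
  have hpt : Filter.Tendsto p (nhdsWithin 0 {0}ᶜ) (nhds (hessianForm (quadLoss a b c) w v / 2)) := by
    have : Continuous p := by fun_prop
    simpa [hp] using (this.tendsto 0).mono_left nhdsWithin_le_nhds
  have hline : Filter.Tendsto (fun t : ℝ => w + t • v) (nhds 0) (nhds w) := by
    have : Continuous fun t : ℝ => w + t • v := by fun_prop
    simpa using this.tendsto 0
  have hev : ∀ᶠ t in nhdsWithin (0 : ℝ) {0}ᶜ, 0 ≤ p t := by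
    filter_upwards [(hline.eventually hw).filter_mono nhdsWithin_le_nhds, self_mem_nhdsWithin]
      with t ht ht0
    rw [quadLoss_add_smul hb, hw.fderiv_eq_zero] at ht
    have h2 : 0 < t ^ 2 := by have : t ≠ 0 := ht0; positivity
    have : 0 ≤ t ^ 2 * p t := by
      simp only [hp]
      rw [zero_apply, mul_zero, add_zero] at ht
      linarith
    exact nonneg_of_mul_nonneg_right this h2
  have := ge_of_tendsto hpt hev
  linarith

theorem isSecondOrderMin_quadLoss_of_zero [CompleteSpace E] (ha : 0 ≤ a)
    (hb : ∀ k u v, b k u v = b k v u) {w : E} (hw : ∀ k, b k w w = c k) :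
    IsSecondOrderMin (quadLoss a b c) w := by
  refine ⟨gradient_eq_zero_iff.2 ?_, fun v => ?_⟩
  · simp [fderiv_quadLoss hb, hw]
  · rw [hessianForm_quadLoss hb]
    refine mul_nonneg ha (Finset.sum_nonneg fun k _ => ?_)
    rw [hw k]
    nlinarith [sq_nonneg (b k w v)]

end QuadraticLoss

/-! ### Nets of the sphere and quadratic forms. -/

section Nets

variable {E : Type*} [NormedAddCommGroup E] [InnerProductSpace ℝ E]

/-- A maximal `1/2`-separated subset of the unit sphere. -/
theorem exists_half_net_sphere (E : Type*) [NormedAddCommGroup E] [InnerProductSpace ℝ E]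
    [FiniteDimensional ℝ E] :
    ∃ N : Finset E, N.card ≤ 5 ^ Module.finrank ℝ E ∧ (∀ a ∈ N, ‖a‖ = 1) ∧
      ∀ x : E, ‖x‖ = 1 → ∃ a ∈ N, ‖x - a‖ ≤ 1 / 2 := by
  classical
  let P : ℕ → Prop := fun n => ∃ N : Finset E, N.card = n ∧ (∀ a ∈ N, ‖a‖ = 1) ∧
    ∀ a ∈ N, ∀ d ∈ N, a ≠ d → 1 / 2 ≤ ‖a - d‖
  have hbound : ∀ N : Finset E, (∀ a ∈ N, ‖a‖ = 1) →
      (∀ a ∈ N, ∀ d ∈ N, a ≠ d → 1 / 2 ≤ ‖a - d‖) → N.card ≤ 5 ^ Module.finrank ℝ E := by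
    intro N h1 h2
    -- Doubling turns the set into a `1`-separated one in the ball of radius `2`, which is the
    -- normalization of the Besicovitch bound `5 ^ dim`.
    have hinj : Function.Injective fun a : E => (2 : ℝ) • a :=
      smul_right_injective E (two_ne_zero)
    rw [← Finset.card_image_of_injective N hinj]
    refine Besicovitch.card_le_of_separated _ ?_ ?_
    · simp only [Finset.mem_image, forall_exists_index, and_imp, forall_apply_eq_imp_iff₂]
      intro a ha
      simp [norm_smul, h1 a ha]
    · simp only [Finset.mem_image, forall_exists_index, and_imp, forall_apply_eq_imp_iff₂]
      intro a ha d hd had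
      rw [← smul_sub, norm_smul, Real.norm_eq_abs, abs_two]
      have := h2 a ha d hd (fun h => had (by rw [h]))
      linarith
  have hP0 : P 0 := ⟨∅, by simp⟩
  obtain ⟨N, hcard, h1, h2⟩ : P (Nat.findGreatest P (5 ^ Module.finrank ℝ E)) :=
    Nat.findGreatest_spec (Nat.zero_le _) hP0
  refine ⟨N, hbound N h1 h2, h1, fun x hx => ?_⟩
  by_contra! hcon
  have hxN : x ∉ N := fun h => by have := hcon x h; norm_num at this
  have h1' : ∀ a ∈ insert x N, ‖a‖ = 1 := by
    intro a ha
    rcases Finset.mem_insert.1 ha with rfl | ha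
    exacts [hx, h1 a ha]
  have h2' : ∀ a ∈ insert x N, ∀ d ∈ insert x N, a ≠ d → 1 / 2 ≤ ‖a - d‖ := by
    intro a ha d hd had
    rcases Finset.mem_insert.1 ha with rfl | ha' <;> rcases Finset.mem_insert.1 hd with rfl | hd'
    · exact absurd rfl had
    · exact (hcon d hd').le
    · rw [norm_sub_rev]; exact (hcon a ha').le
    · exact h2 a ha' d hd' had
  have := Nat.le_findGreatest (hbound _ h1' h2') (show P _ from ⟨_, rfl, h1', h2'⟩)
  rw [Finset.card_insert_of_notMem hxN] at this
  omega

/-- A symmetric bilinear form is controlled by the values of its quadratic form. -/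
theorem abs_bilin_le_of_quadratic_le {T : E →L[ℝ] E →L[ℝ] ℝ} (hT : ∀ u v, T u v = T v u) {K : ℝ}
    (hK : ∀ x, |T x x| ≤ K * ‖x‖ ^ 2) (u v : E) : |T u v| ≤ K * (‖u‖ * ‖v‖) := by
  have key : ∀ u v : E, ‖u‖ = 1 → ‖v‖ = 1 → |T u v| ≤ K := by
    intro u v hu hv
    have h1 := hK (u + v)
    have h2 := hK (u - v)
    have hpar := parallelogram_law_with_norm ℝ u v
    have e : 4 * T u v = T (u + v) (u + v) - T (u - v) (u - v) := by
      simp only [map_add, map_sub, add_apply, sub_apply,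
        hT v u]
      ring
    have h3 : |4 * T u v| ≤ K * 4 := by
      rw [e]
      refine (abs_sub _ _).trans ((add_le_add h1 h2).trans (le_of_eq ?_))
      rw [← mul_add, hpar, hu, hv]
      norm_num
    rw [abs_mul, abs_of_pos (by norm_num : (0 : ℝ) < 4)] at h3
    linarith
  rcases eq_or_ne u 0 with rfl | hu
  · simp
  rcases eq_or_ne v 0 with rfl | hv
  · simp
  have hu' : ‖u‖ ≠ 0 := norm_ne_zero_iff.2 hu
  have hv' : ‖v‖ ≠ 0 := norm_ne_zero_iff.2 hv
  have h := key (‖u‖⁻¹ • u) (‖v‖⁻¹ • v) (by simp [norm_smul, hu']) (by simp [norm_smul, hv'])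
  simp only [map_smul, smul_apply, smul_eq_mul, abs_mul, abs_inv,
    abs_norm] at h
  have hpos : 0 < ‖u‖ * ‖v‖ := by positivity
  rw [← div_le_iff₀ hpos]
  refine le_trans (le_of_eq ?_) h
  field_simp

/-- A quadratic form that is small on a `1/2`-net of the unit sphere is small everywhere. -/
theorem abs_quadratic_le_of_net [FiniteDimensional ℝ E] {N : Finset E} (hN1 : ∀ a ∈ N, ‖a‖ = 1)
    (hN : ∀ x : E, ‖x‖ = 1 → ∃ a ∈ N, ‖x - a‖ ≤ 1 / 2) {T : E →L[ℝ] E →L[ℝ] ℝ}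
    (hT : ∀ u v, T u v = T v u) {t : ℝ} (ht : ∀ a ∈ N, |T a a| ≤ t) (x : E) :
    |T x x| ≤ 32 * t * ‖x‖ ^ 2 := by
  have hscale : ∀ K : ℝ, (∀ x : E, ‖x‖ = 1 → |T x x| ≤ K) → ∀ x, |T x x| ≤ K * ‖x‖ ^ 2 := by
    intro K hK x
    rcases eq_or_ne x 0 with rfl | hx
    · simp
    have hx' : ‖x‖ ≠ 0 := norm_ne_zero_iff.2 hx
    have h := hK (‖x‖⁻¹ • x) (by simp [norm_smul, hx'])
    simp only [map_smul, smul_apply, smul_eq_mul, abs_mul, abs_inv,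
      abs_norm] at h
    rw [← div_le_iff₀ (by positivity)]
    refine le_trans (le_of_eq ?_) h
    field_simp
  refine hscale _ (fun x hx => ?_) x
  have hcomp : IsCompact (Metric.sphere (0 : E) 1) := isCompact_sphere 0 1
  obtain ⟨y, hy, hmax⟩ := hcomp.exists_isMaxOn ⟨x, by simpa using hx⟩
    (show ContinuousOn (fun x : E => |T x x|) _ by fun_prop)
  have hy1 : ‖y‖ = 1 := by simpa using hy
  have hmax' : ∀ x : E, ‖x‖ = 1 → |T x x| ≤ |T y y| := fun x hx => hmax (by simpa using hx)
  refine (hmax' x hx).trans ?_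
  obtain ⟨a, ha, hya⟩ := hN y hy1
  have h1 := abs_bilin_le_of_quadratic_le hT (hscale _ hmax') (y - a) (y + a)
  -- At the maximizer `y`, the difference `T y y - T a a` factors and costs at most `31 / 32` of the
  -- maximum itself. Absorbing it leaves the factor `32`.
  have e : T y y = T a a + T (y - a) (y + a) := by
    simp only [map_add, map_sub, sub_apply, hT a y]
    ring
  have hpar := parallelogram_law_with_norm ℝ y a
  rw [hy1, hN1 a ha] at hpar
  -- With `s = ‖y - a‖ ^ 2 ≤ 1 / 4`, the square is `s * (4 - s) ≤ 15 / 16 < (31 / 32) ^ 2`.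
  have h2 : ‖y - a‖ * ‖y + a‖ ≤ 31 / 32 := by
    have h0 := norm_nonneg (y - a)
    refine abs_le_of_sq_le_sq' ?_ (by norm_num) |>.2
    have : (‖y - a‖ * ‖y + a‖) ^ 2 = ‖y - a‖ ^ 2 * (4 - ‖y - a‖ ^ 2) := by
      rw [mul_pow]; congr 1; linarith
    rw [this]
    have h3 : ‖y - a‖ ^ 2 ≤ 1 / 4 := by nlinarith
    nlinarith [sq_nonneg (‖y - a‖)]
  have h3 : |T y y| ≤ t + |T y y| * (31 / 32) := by
    calc |T y y| ≤ |T a a| + |T (y - a) (y + a)| := by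
          conv_lhs => rw [e]
          exact abs_add_le _ _
      _ ≤ t + |T y y| * (31 / 32) :=
        add_le_add (ht a ha) (h1.trans (mul_le_mul_of_nonneg_left h2 (abs_nonneg _)))
  linarith

end Nets

/-! ### Sums of independent Gaussians. -/

section GaussianSums

variable {Ω : Type*} [MeasurableSpace Ω] {μ : Measure Ω}

/-- Sums over the rows of an independent array are independent. -/
theorem iIndepFun_row_sums {ι κ : Type*} [Fintype ι] [Fintype κ] {Y : ι × κ → Ω → ℝ}
    (hm : ∀ p, Measurable (Y p)) (hY : iIndepFun Y μ) :
    iIndepFun (fun k ω => ∑ q, Y (k, q) ω) μ := by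
  have := hY.isProbabilityMeasure
  have hrow : ∀ k, Measurable fun ω => ∑ q, Y (k, q) ω := fun k =>
    Finset.measurable_sum _ fun q _ => hm (k, q)
  -- The joint characteristic function of the row sums at `t` is that of the single sum of all `t k
  -- * Y (k, q)` at `1`; independence of the whole array factors it row by row.
  rw [iIndepFun_iff_charFun_pi fun k => (hrow k).aemeasurable]
  intro t
  have h1 : charFun (μ.map fun ω => WithLp.toLp 2 fun k => ∑ q, Y (k, q) ω) t =
      charFun (μ.map fun ω => ∑ p : ι × κ, t p.1 * Y p ω) 1 := by
    rw [charFun_apply, charFun_apply, integral_map, integral_map]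
    · refine integral_congr_ae (Filter.Eventually.of_forall fun ω => ?_)
      simp [PiLp.inner_apply, Fintype.sum_prod_type, Finset.mul_sum]
    · exact (Finset.measurable_sum _ fun p _ => (hm p).const_mul _).aemeasurable
    · fun_prop
    · fun_prop
    · fun_prop
  have h2 : ∀ (X : Ω → ℝ), Measurable X → ∀ s : ℝ,
      charFun (μ.map fun ω => s * X ω) 1 = charFun (μ.map X) s := by
    intro X hX s
    rw [charFun_apply, charFun_apply, integral_map (by fun_prop) (by fun_prop),
      integral_map (by fun_prop) (by fun_prop)]
    simp [mul_comm]
  have h3 : iIndepFun (fun (p : ι × κ) ω => t p.1 * Y p ω) μ :=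
    hY.comp (fun p x => t p.1 * x) fun p => by fun_prop
  rw [h1, h3.charFun_map_fun_sum_eq_prod fun p => ((hm p).const_mul _).aemeasurable]
  rw [Finset.prod_apply, Fintype.prod_prod_type]
  refine Finset.prod_congr rfl fun k _ => ?_
  have h4 : iIndepFun (fun q ω => Y (k, q) ω) μ :=
    hY.precomp (g := fun q => (k, q)) (Prod.mk_right_injective k)
  rw [h4.charFun_map_fun_sum_eq_prod fun q => (hm (k, q)).aemeasurable, Finset.prod_apply]
  exact Finset.prod_congr rfl fun q _ => h2 _ (hm (k, q)) _

/-- A sum of independent centred Gaussians is a centred Gaussian. -/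
theorem map_sum_eq_gaussianReal {κ : Type*} [Fintype κ] {Y : κ → Ω → ℝ} {v : κ → ℝ≥0}
    (hm : ∀ q, Measurable (Y q)) (hY : iIndepFun Y μ)
    (hlaw : ∀ q, μ.map (Y q) = gaussianReal 0 (v q)) :
    μ.map (fun ω => ∑ q, Y q ω) = gaussianReal 0 (∑ q, v q) := by
  have := hY.isProbabilityMeasure
  refine Measure.ext_of_charFun ?_
  ext t
  rw [hY.charFun_map_fun_sum_eq_prod fun q => (hm q).aemeasurable, Finset.prod_apply]
  simp only [hlaw, charFun_gaussianReal]
  rw [← Complex.exp_sum]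
  congr 1
  simp [Finset.sum_mul, Finset.sum_div]

theorem map_ofReal_mul_re (w : ℂ) :
    ((gaussianReal 0 1).map fun t : ℝ => (t : ℂ)).map (fun z => (z * w).re) =
      gaussianReal 0 (.mk (w.re ^ 2) (sq_nonneg _)) := by
  rw [Measure.map_map (by fun_prop) (by fun_prop)]
  have h : (fun z : ℂ => (z * w).re) ∘ (fun t : ℝ => (t : ℂ)) = fun t => w.re * t := by
    ext t; simp [mul_comm]
  rw [h, gaussianReal_map_const_mul]
  simp

/-- The factor `2` is the joint contribution of an entry and its mirror image; the variance `4 * ‖w‖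
^ 2 / 2` equals the share of both in a squared Frobenius norm. -/
theorem map_complexGaussian_mul_re (w : ℂ) :
    (((gaussianReal 0 (1 / 2)).prod (gaussianReal 0 (1 / 2))).map
        (fun p : ℝ × ℝ => (p.1 : ℂ) + (p.2 : ℂ) * Complex.I)).map (fun z => 2 * (z * w).re) =
      gaussianReal 0 (.mk (2 * ‖w‖ ^ 2) (by positivity)) := by
  rw [Measure.map_map (by fun_prop) (by fun_prop)]
  have h : (fun z : ℂ => 2 * (z * w).re) ∘
      (fun p : ℝ × ℝ => (p.1 : ℂ) + (p.2 : ℂ) * Complex.I) =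
      (fun p : ℝ × ℝ => p.1 + p.2) ∘ Prod.map (fun x => (2 * w.re) * x) fun x => (-2 * w.im) * x := by
    ext p; simp; ring
  rw [h, ← Measure.map_map (by fun_prop) (by fun_prop),
    ← Measure.map_prod_map _ _ (by fun_prop) (by fun_prop), gaussianReal_map_const_mul,
    gaussianReal_map_const_mul]
  change Measure.conv _ _ = _
  rw [gaussianReal_conv_gaussianReal]
  congr 1
  · simp
  · rw [← NNReal.coe_inj]
    simp only [NNReal.coe_add, NNReal.coe_mul, NNReal.coe_mk, one_div, NNReal.coe_inv,
      NNReal.coe_ofNat, Complex.sq_norm, Complex.normSq_apply]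
    ring

end GaussianSums

/-! ### Chi-square concentration. -/

section ChiSquare

theorem integral_exp_mul_sq_gaussianReal {v : ℝ≥0} {l : ℝ} (h : 2 * l * v < 1) :
    ∫ x, Real.exp (l * x ^ 2) ∂gaussianReal 0 v = (√(1 - 2 * l * v))⁻¹ := by
  rcases eq_or_ne v 0 with rfl | hv
  · simp
  have hv' : (0 : ℝ) < v := by positivity
  rw [integral_gaussianReal_eq_integral_smul hv]
  have e : ∀ x : ℝ, gaussianPDFReal 0 v x • Real.exp (l * x ^ 2) =
      (√(2 * Real.pi * v))⁻¹ * Real.exp (-((1 - 2 * l * v) / (2 * v)) * x ^ 2) := by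
    intro x
    rw [gaussianPDFReal, smul_eq_mul, mul_assoc, ← Real.exp_add]
    congr 2
    field_simp
    ring
  simp_rw [e]
  have h1 : 0 < 1 - 2 * l * v := by linarith
  rw [integral_const_mul, integral_gaussian, ← Real.sqrt_inv, ← Real.sqrt_inv,
    ← Real.sqrt_mul (by positivity)]
  congr 1
  have := Real.pi_pos
  field_simp

theorem integrable_exp_mul_sq_gaussianReal {v : ℝ≥0} {l : ℝ} (h : 2 * l * v < 1) :
    Integrable (fun x => Real.exp (l * x ^ 2)) (gaussianReal 0 v) := by
  by_contra hcon
  -- The integral of a non-integrable function is `0` by convention, while the closed formula is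
  -- positive.
  have h1 := integral_exp_mul_sq_gaussianReal h
  rw [integral_undef hcon] at h1
  have : 0 < √(1 - 2 * l * v) := Real.sqrt_pos.2 (by linarith)
  exact (inv_pos.2 this).ne h1

/-- This bounds `(√(1 - y))⁻¹` by `exp (y / 2 + y ^ 2 / 2)`; centring the square removes the linear
term, leaving a sub-Gaussian estimate. -/
theorem exp_neg_sub_sq_le_one_sub {y : ℝ} (hy : |y| ≤ 1 / 4) : Real.exp (-y - y ^ 2) ≤ 1 - y := by
  obtain ⟨h1, h2⟩ := abs_le.1 hy
  have e : -y - y ^ 2 = -(y + y ^ 2) := by ring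
  rw [e, Real.exp_neg, inv_le_comm₀ (Real.exp_pos _) (by linarith), inv_le_iff_one_le_mul₀ (by linarith)]
  rcases le_total y 0 with h | h
  · have := Real.add_one_le_exp (y + y ^ 2)
    have h3 : (y + y ^ 2 + 1) * (1 - y) ≤ Real.exp (y + y ^ 2) * (1 - y) :=
      mul_le_mul_of_nonneg_right this (by linarith)
    nlinarith [mul_nonneg (sq_nonneg y) (neg_nonneg.2 h)]
  · have := Real.quadratic_le_exp_of_nonneg (show 0 ≤ y + y ^ 2 by positivity)
    have h3 : (1 + (y + y ^ 2) + (y + y ^ 2) ^ 2 / 2) * (1 - y) ≤ Real.exp (y + y ^ 2) * (1 - y) :=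
      mul_le_mul_of_nonneg_right this (by linarith)
    refine le_trans ?_ h3
    have h4 : 0 ≤ y ^ 2 := sq_nonneg y
    have h5 : 0 ≤ y ^ 3 := by positivity
    nlinarith [mul_nonneg h4 (sub_nonneg.2 h2), mul_nonneg h5 (sub_nonneg.2 h2)]

/-- The moment generating function of a centred square of a Gaussian of variance at most `1`. -/
theorem integral_exp_mul_sq_sub_le {v : ℝ≥0} (hv : v ≤ 1) {l : ℝ} (hl : |l| ≤ 1 / 8) :
    ∫ x, Real.exp (l * (x ^ 2 - v)) ∂gaussianReal 0 v ≤ Real.exp (2 * l ^ 2) := by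
  have hv0 : (0 : ℝ) ≤ v := v.2
  have hv1 : (v : ℝ) ≤ 1 := by exact_mod_cast hv
  set y : ℝ := 2 * l * v with hy
  have hyl : |y| ≤ 1 / 4 := by
    rw [hy, abs_mul, abs_mul, abs_two, abs_of_nonneg hv0]
    nlinarith [abs_nonneg l]
  have hy1 : y < 1 := by linarith [(abs_le.1 hyl).2]
  have e : ∀ x : ℝ, Real.exp (l * (x ^ 2 - v)) = Real.exp (l * x ^ 2) * Real.exp (-(y / 2)) := by
    intro x
    rw [← Real.exp_add]
    congr 1
    rw [hy]; ring
  simp_rw [e]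
  rw [integral_mul_const, integral_exp_mul_sq_gaussianReal hy1]
  have hs : Real.exp ((-y - y ^ 2) / 2) ≤ √(1 - y) := by
    refine Real.le_sqrt_of_sq_le ?_
    rw [← Real.exp_nat_mul]
    refine le_trans (le_of_eq ?_) (exp_neg_sub_sq_le_one_sub hyl)
    congr 1
    push_cast
    ring
  calc (√(1 - y))⁻¹ * Real.exp (-(y / 2))
      ≤ (Real.exp ((-y - y ^ 2) / 2))⁻¹ * Real.exp (-(y / 2)) := by gcongr
    _ = Real.exp (y ^ 2 / 2) := by
        rw [← Real.exp_neg, ← Real.exp_add]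
        congr 1
        ring
    _ ≤ Real.exp (2 * l ^ 2) := by
        refine Real.exp_le_exp.2 ?_
        rw [hy, mul_pow, mul_pow]
        have : (v : ℝ) ^ 2 ≤ 1 := pow_le_one₀ hv0 hv1
        nlinarith [sq_nonneg l]

variable {Ω : Type*} [MeasurableSpace Ω] {μ : Measure Ω}

/-- Concentration of a sum of squares of independent Gaussians of variance at most `1`. -/
theorem measure_abs_sum_sq_sub_ge_le {ι : Type*} [Fintype ι] {X : ι → Ω → ℝ} {v : ℝ≥0}
    (hv : v ≤ 1) (hm : ∀ k, Measurable (X k)) (hX : iIndepFun X μ)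
    (hlaw : ∀ k, μ.map (X k) = gaussianReal 0 v) {t : ℝ} (ht0 : 0 ≤ t) (ht : t ≤ 1 / 2) :
    μ.real {ω | Fintype.card ι * t ≤ |∑ k, (X k ω ^ 2 - v)|} ≤
      2 * Real.exp (-(Fintype.card ι * t ^ 2 / 8)) := by
  have := hX.isProbabilityMeasure
  set m : ℝ := (Fintype.card ι : ℝ) with hmdef
  let Y : ι → Ω → ℝ := fun k ω => X k ω ^ 2 - v
  have hYm : ∀ k, Measurable (Y k) := fun k => ((hm k).pow_const 2).sub_const _
  have hY : iIndepFun Y μ := hX.comp (fun _ x => x ^ 2 - (v : ℝ)) fun _ => by fun_prop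
  have hl : ∀ l : ℝ, |l| ≤ 1 / 8 → 2 * l * v < 1 := by
    intro l hl
    have hv1 : (v : ℝ) ≤ 1 := by exact_mod_cast hv
    have := (abs_le.1 hl).2
    nlinarith [v.2]
  have hint : ∀ l : ℝ, |l| ≤ 1 / 8 → ∀ k, Integrable (fun ω => Real.exp (l * Y k ω)) μ := by
    intro l hll k
    have h1 : Integrable (fun x : ℝ => Real.exp (l * (x ^ 2 - v))) (μ.map (X k)) := by
      rw [hlaw k]
      refine ((integrable_exp_mul_sq_gaussianReal (hl l hll)).mul_const
        (Real.exp (-(l * v)))).congr (Filter.Eventually.of_forall fun x => ?_)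
      simp only
      rw [← Real.exp_add]
      congr 1
      ring
    exact h1.comp_measurable (hm k)
  have hmgf : ∀ l : ℝ, |l| ≤ 1 / 8 → mgf (∑ k, Y k) μ l ≤ Real.exp (m * (2 * l ^ 2)) := by
    intro l hll
    rw [hY.mgf_sum hYm, hmdef, Real.exp_nat_mul]
    rw [← Finset.card_univ, ← Finset.prod_const]
    refine Finset.prod_le_prod (fun k _ => mgf_nonneg) fun k _ => ?_
    have h1 : mgf (Y k) μ l = ∫ x, Real.exp (l * (x ^ 2 - v)) ∂(μ.map (X k)) := by
      rw [integral_map (hm k).aemeasurable (by fun_prop)]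
      rfl
    rw [h1, hlaw k]
    exact integral_exp_mul_sq_sub_le hv hll
  have hsumint : ∀ l : ℝ, |l| ≤ 1 / 8 →
      Integrable (fun ω => Real.exp (l * (∑ k, Y k) ω)) μ := fun l hll =>
    hY.integrable_exp_mul_sum hYm fun k _ => hint l hll k
  have hup : μ.real {ω | m * t ≤ (∑ k, Y k) ω} ≤ Real.exp (-(m * t ^ 2 / 8)) := by
    -- `l = t / 4` minimizes the Chernoff exponent `-l * t + 2 * l ^ 2`, with value `-t ^ 2 / 8`;
    -- the bound `t ≤ 1 / 2` keeps `l` in the admissible range.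
    have hll : |t / 4| ≤ 1 / 8 := by rw [abs_of_nonneg (by positivity)]; linarith
    refine (measure_ge_le_exp_mul_mgf (m * t) (by positivity) (hsumint _ hll)).trans ?_
    refine (mul_le_mul_of_nonneg_left (hmgf _ hll) (Real.exp_pos _).le).trans (le_of_eq ?_)
    rw [← Real.exp_add]
    congr 1
    ring
  have hlow : μ.real {ω | (∑ k, Y k) ω ≤ -(m * t)} ≤ Real.exp (-(m * t ^ 2 / 8)) := by
    have hll : |-(t / 4)| ≤ 1 / 8 := by rw [abs_neg, abs_of_nonneg (by positivity)]; linarith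
    refine (measure_le_le_exp_mul_mgf (-(m * t)) (by simp; positivity) (hsumint _ hll)).trans ?_
    refine (mul_le_mul_of_nonneg_left (hmgf _ hll) (Real.exp_pos _).le).trans (le_of_eq ?_)
    rw [← Real.exp_add]
    congr 1
    ring
  have hsub : {ω | m * t ≤ |∑ k, (X k ω ^ 2 - v)|} ⊆
      {ω | m * t ≤ (∑ k, Y k) ω} ∪ {ω | (∑ k, Y k) ω ≤ -(m * t)} := by
    intro ω hω
    have hω' : m * t ≤ |∑ k, (X k ω ^ 2 - v)| := hω
    rcases le_abs.1 hω' with h | h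
    · left; simpa [Y] using h
    · right
      have : ∑ k, (X k ω ^ 2 - v) ≤ -(m * t) := by linarith
      simpa [Y] using this
  calc _ ≤ μ.real ({ω | m * t ≤ (∑ k, Y k) ω} ∪ {ω | (∑ k, Y k) ω ≤ -(m * t)}) :=
        measureReal_mono hsub
    _ ≤ _ := measureReal_union_le _ _
    _ ≤ _ := by linarith

end ChiSquare

/-! ### The real form of a Hermitian matrix and the norm of symmetrized outer products. -/

section RealForm

variable {n : ℕ}

/-- The real bilinear form `(u, v) ↦ Re ⟨A u, v⟩` on `ℂⁿ`. -/
noncomputable def realForm (A : Matrix (Fin n) (Fin n) ℂ) :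
    EuclideanSpace ℂ (Fin n) →L[ℝ] EuclideanSpace ℂ (Fin n) →L[ℝ] ℝ :=
  LinearMap.toContinuousBilinearMap
    (LinearMap.mk₂ ℝ (fun u v => ∑ i, ∑ j, (A i j * (u j * conj (v i))).re)
      (fun u u' v => by
        simp only [← Finset.sum_add_distrib, ← Complex.add_re]
        refine Finset.sum_congr rfl fun i _ => Finset.sum_congr rfl fun j _ => ?_
        simp only [PiLp.add_apply]
        ring_nf)
      (fun c u v => by
        simp only [Finset.smul_sum]
        refine Finset.sum_congr rfl fun i _ => Finset.sum_congr rfl fun j _ => ?_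
        simp only [PiLp.smul_apply, ← Complex.smul_re]
        simp only [Complex.real_smul]
        ring_nf)
      (fun u v v' => by
        simp only [← Finset.sum_add_distrib, ← Complex.add_re]
        refine Finset.sum_congr rfl fun i _ => Finset.sum_congr rfl fun j _ => ?_
        simp only [PiLp.add_apply, map_add]
        ring_nf)
      (fun c u v => by
        simp only [Finset.smul_sum]
        refine Finset.sum_congr rfl fun i _ => Finset.sum_congr rfl fun j _ => ?_
        simp only [PiLp.smul_apply, ← Complex.smul_re]
        simp only [Complex.real_smul, map_mul, Complex.conj_ofReal]
        ring_nf))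

theorem realForm_apply (A : Matrix (Fin n) (Fin n) ℂ) (u v : EuclideanSpace ℂ (Fin n)) :
    realForm A u v = ∑ i, ∑ j, (A i j * (u j * conj (v i))).re := rfl

theorem realForm_comm {A : Matrix (Fin n) (Fin n) ℂ} (hA : A.IsHermitian)
    (u v : EuclideanSpace ℂ (Fin n)) : realForm A u v = realForm A v u := by
  rw [realForm_apply, realForm_apply, Finset.sum_comm]
  refine Finset.sum_congr rfl fun j _ => Finset.sum_congr rfl fun i _ => ?_
  rw [← Complex.conj_re, ← hA.apply]
  simp [mul_comm]

theorem quadForm_eq_realForm {A : Matrix (Fin n) (Fin n) ℂ} (hA : A.IsHermitian)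
    (x : EuclideanSpace ℂ (Fin n)) : quadForm A x = realForm A x x := by
  have h : quadForm A x = ∑ i, ∑ j, A i j * (x j * conj (x i)) := by
    simp only [quadForm, Matrix.mulVec, dotProduct, Finset.sum_mul, mul_assoc]
  rw [h]
  refine Complex.ext ?_ ?_
  · simp [realForm_apply]
  · have : conj (∑ i, ∑ j, A i j * (x j * conj (x i))) = ∑ i, ∑ j, A i j * (x j * conj (x i)) := by
      simp only [map_sum]
      rw [Finset.sum_comm]
      refine Finset.sum_congr rfl fun j _ => Finset.sum_congr rfl fun i _ => ?_
      rw [← hA.apply j i]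
      simp [mul_comm]
    rw [Complex.conj_eq_iff_im.1 this, Complex.ofReal_im]

/-- The Hermitian matrix `(u v* + v u*) / 2`, transposed. -/
noncomputable def symOuter (u v : EuclideanSpace ℂ (Fin n)) (i j : Fin n) : ℂ :=
  (u j * conj (v i) + v j * conj (u i)) / 2

theorem conj_symOuter (u v : EuclideanSpace ℂ (Fin n)) (i j : Fin n) :
    conj (symOuter u v i j) = symOuter u v j i := by
  simp only [symOuter, map_div₀, map_add, map_mul, Complex.conj_conj, Complex.conj_ofNat]
  ring

/-- Symmetrizing the coefficients makes the terms at `(i, j)` and `(j, i)` equal, so that only the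
independent entries on and above the diagonal remain. -/
theorem realForm_eq_sum_symOuter {A : Matrix (Fin n) (Fin n) ℂ} (hA : A.IsHermitian)
    (u v : EuclideanSpace ℂ (Fin n)) :
    realForm A u v = ∑ i, ∑ j, (A i j * symOuter u v i j).re := by
  have h : realForm A u v = (realForm A u v + realForm A v u) / 2 := by
    rw [realForm_comm hA v u]; ring
  rw [h, realForm_apply, realForm_apply]
  simp only [← Finset.sum_add_distrib, Finset.sum_div]
  refine Finset.sum_congr rfl fun i _ => Finset.sum_congr rfl fun j _ => ?_
  rw [← Complex.add_re, ← mul_add, symOuter, ← mul_div_assoc]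
  simp

/-- The squared Frobenius norm of `(u v* + v u*) / 2`. -/
noncomputable def symOuterSq (u v : EuclideanSpace ℂ (Fin n)) : ℝ :=
  (‖u‖ ^ 2 * ‖v‖ ^ 2 + (inner ℂ u v).re ^ 2 - (inner ℂ u v).im ^ 2) / 2

theorem sum_norm_symOuter_sq (u v : EuclideanSpace ℂ (Fin n)) :
    ∑ i, ∑ j, ‖symOuter u v i j‖ ^ 2 = symOuterSq u v := by
  have h1 : ∀ i j, ‖symOuter u v i j‖ ^ 2 =
      (‖u j‖ ^ 2 * ‖v i‖ ^ 2 + ‖v j‖ ^ 2 * ‖u i‖ ^ 2 +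
        2 * ((v i * conj (u i)) * (v j * conj (u j))).re) / 4 := by
    intro i j
    simp only [symOuter, Complex.sq_norm, Complex.normSq_apply]
    simp
    ring
  have h2 : inner ℂ u v = ∑ i, v i * conj (u i) := by
    simp [PiLp.inner_apply]
  have h3 : ∑ i, ∑ j, ((v i * conj (u i)) * (v j * conj (u j))).re =
      (inner ℂ u v).re ^ 2 - (inner ℂ u v).im ^ 2 := by
    have : (inner ℂ u v).re ^ 2 - (inner ℂ u v).im ^ 2 = (inner ℂ u v * inner ℂ u v).re := by
      rw [Complex.mul_re]; ring
    rw [this, h2, Finset.sum_mul_sum]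
    simp
  have h4 : ∑ i, ∑ j, ‖u j‖ ^ 2 * ‖v i‖ ^ 2 = ‖u‖ ^ 2 * ‖v‖ ^ 2 := by
    rw [EuclideanSpace.norm_sq_eq, EuclideanSpace.norm_sq_eq, Finset.sum_mul_sum, Finset.sum_comm]
  have h5 : ∑ i, ∑ j, ‖v j‖ ^ 2 * ‖u i‖ ^ 2 = ‖u‖ ^ 2 * ‖v‖ ^ 2 := by
    rw [EuclideanSpace.norm_sq_eq, EuclideanSpace.norm_sq_eq, Finset.sum_mul_sum]
    simp only [mul_comm]
  simp only [h1, ← Finset.sum_div, Finset.sum_add_distrib, ← Finset.mul_sum, h3] at *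
  rw [h4, h5, symOuterSq]
  ring

theorem symOuterSq_comm (u v : EuclideanSpace ℂ (Fin n)) : symOuterSq u v = symOuterSq v u := by
  rw [symOuterSq, symOuterSq, ← inner_conj_symm u v, Complex.conj_re, Complex.conj_im]
  ring

theorem symOuterSq_nonneg (u v : EuclideanSpace ℂ (Fin n)) : 0 ≤ symOuterSq u v := by
  rw [← sum_norm_symOuter_sq]
  positivity

theorem symOuterSq_le (u v : EuclideanSpace ℂ (Fin n)) : symOuterSq u v ≤ ‖u‖ ^ 2 * ‖v‖ ^ 2 := by
  have h1 : ‖inner ℂ u v‖ ^ 2 ≤ (‖u‖ * ‖v‖) ^ 2 :=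
    pow_le_pow_left₀ (norm_nonneg _) (norm_inner_le_norm u v) 2
  rw [Complex.sq_norm, Complex.normSq_apply, mul_pow] at h1
  rw [symOuterSq]
  nlinarith [sq_nonneg (inner ℂ u v).im]

/-- Polarization: `xx* - zz*` is the Hermitian part of `(x + z)(x - z)*`. -/
theorem outerDist_sq (x z : EuclideanSpace ℂ (Fin n)) :
    outerDist x z ^ 2 = symOuterSq (x + z) (x - z) := by
  rw [← sum_norm_symOuter_sq, outerDist, Matrix.frobenius_norm_def, ← Real.sqrt_eq_rpow,
    Real.sq_sqrt (by positivity), Finset.sum_comm]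
  refine Finset.sum_congr rfl fun i _ => Finset.sum_congr rfl fun j _ => ?_
  rw [Real.rpow_two]
  congr 2
  simp [symOuter, Matrix.vecMulVec_apply]
  ring

/-- The restricted isometry property passes from pairs in a net to all pairs. -/
theorem abs_mean_sub_symOuterSq_le_of_net {m : ℕ}
    {b : Fin m → EuclideanSpace ℂ (Fin n) →L[ℝ] EuclideanSpace ℂ (Fin n) →L[ℝ] ℝ}
    (hb : ∀ k u v, b k u v = b k v u)
    {N : Finset (EuclideanSpace ℂ (Fin n))} (hN1 : ∀ a ∈ N, ‖a‖ = 1)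
    (hN : ∀ x : EuclideanSpace ℂ (Fin n), ‖x‖ = 1 → ∃ a ∈ N, ‖x - a‖ ≤ 1 / 2) {t : ℝ}
    (ht : ∀ u ∈ N, ∀ v ∈ N, |(1 / (m : ℝ)) * ∑ k, b k u v ^ 2 - symOuterSq u v| ≤ t)
    (u v : EuclideanSpace ℂ (Fin n)) :
    |(1 / (m : ℝ)) * ∑ k, b k u v ^ 2 - symOuterSq u v| ≤ 1024 * t * (‖u‖ ^ 2 * ‖v‖ ^ 2) := by
  have key : ∀ (u : EuclideanSpace ℂ (Fin n)) (s : ℝ),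
      (∀ v ∈ N, |(1 / (m : ℝ)) * ∑ k, b k u v ^ 2 - symOuterSq u v| ≤ s) →
      ∀ v, |(1 / (m : ℝ)) * ∑ k, b k u v ^ 2 - symOuterSq u v| ≤ 32 * s * ‖v‖ ^ 2 := by
    intro u s hs v
    let p : EuclideanSpace ℂ (Fin n) →L[ℝ] ℝ :=
      Complex.reCLM ∘L (innerSL ℂ u).restrictScalars ℝ
    let q : EuclideanSpace ℂ (Fin n) →L[ℝ] ℝ :=
      Complex.imCLM ∘L (innerSL ℂ u).restrictScalars ℝ
    -- For fixed `u` the deviation is a real quadratic form in `v`, since `symOuterSq u` is; `T` is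
    -- its polarization.
    let T : EuclideanSpace ℂ (Fin n) →L[ℝ] EuclideanSpace ℂ (Fin n) →L[ℝ] ℝ :=
      (1 / (m : ℝ)) • (∑ k, (b k u).smulRight (b k u)) -
        (1 / 2 : ℝ) • (‖u‖ ^ 2 • (innerₗ (EuclideanSpace ℂ (Fin n))).toContinuousBilinearMap +
          p.smulRight p - q.smulRight q)
    have hTsymm : ∀ v w, T v w = T w v := by
      intro v w
      simp [T, mul_comm, real_inner_comm]
    have hTdiag : ∀ v, T v v = (1 / (m : ℝ)) * ∑ k, b k u v ^ 2 - symOuterSq u v := by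
      intro v
      simp [T, p, q, symOuterSq, pow_two]
      ring
    rw [← hTdiag]
    exact abs_quadratic_le_of_net hN1 hN hTsymm (fun a ha => by rw [hTdiag]; exact hs a ha) v
  have hswap : ∀ u v : EuclideanSpace ℂ (Fin n), (1 / (m : ℝ)) * ∑ k, b k u v ^ 2 - symOuterSq u v
      = (1 / (m : ℝ)) * ∑ k, b k v u ^ 2 - symOuterSq v u := by
    intro u v
    rw [symOuterSq_comm]
    simp only [hb _ u v]
  rw [hswap]
  -- The net argument is used once in each variable, whence `32 ^ 2 = 1024`.
  refine (key v (32 * t * ‖v‖ ^ 2) (fun a ha => ?_) u).trans (le_of_eq (by ring))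
  rw [hswap]
  exact key a t (ht a ha) v

end RealForm

/-! ### Restricted isometry for Gaussian measurements. -/

section GaussianMeasurements

variable {n m : ℕ}

/-- The sum of a symmetric array in terms of its entries on and above the diagonal. -/
theorem sum_symm_eq_sum_upper {g : Fin n → Fin n → ℝ} (hg : ∀ i j, g i j = g j i) :
    ∑ i, ∑ j, g i j = ∑ q : {q : Fin n × Fin n // q.1 ≤ q.2},
      (if q.1.1 = q.1.2 then 1 else 2) * g q.1.1 q.1.2 := by
  have h1 : ∑ i, ∑ j, g i j =
      ∑ i, ∑ j, (if i ≤ j then g i j else 0) + ∑ i, ∑ j, (if j < i then g i j else 0) := by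
    simp only [← Finset.sum_add_distrib]
    refine Finset.sum_congr rfl fun i _ => Finset.sum_congr rfl fun j _ => ?_
    rcases le_or_gt i j with h | h
    · simp [h, h.not_gt]
    · simp [h, h.not_ge]
  have h2 : ∑ i, ∑ j, (if j < i then g i j else 0) = ∑ i, ∑ j, (if i < j then g i j else 0) := by
    rw [Finset.sum_comm]
    simp only [hg]
  have h3 : ∑ q : {q : Fin n × Fin n // q.1 ≤ q.2},
      (if q.1.1 = q.1.2 then 1 else 2) * g q.1.1 q.1.2 =
      ∑ q : Fin n × Fin n, if q.1 ≤ q.2 then (if q.1 = q.2 then 1 else 2) * g q.1 q.2 else 0 := by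
    rw [← Finset.sum_filter]
    exact (Finset.sum_subtype (p := fun q : Fin n × Fin n => q.1 ≤ q.2) _ (by simp)
      (fun q => (if q.1 = q.2 then 1 else 2) * g q.1 q.2)).symm
  rw [h3, Fintype.sum_prod_type, h1, h2, ← Finset.sum_add_distrib]
  refine Finset.sum_congr rfl fun i _ => ?_
  rw [← Finset.sum_add_distrib]
  refine Finset.sum_congr rfl fun j _ => ?_
  rcases lt_trichotomy i j with h | h | h
  · simp [h, h.le, h.ne, two_mul]
  · simp [h]
  · simp [h.not_ge, h.not_gt]

variable {Ω : Type*} [MeasurableSpace Ω] {μ : Measure Ω}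
  {A : Fin m → Ω → Matrix (Fin n) (Fin n) ℂ}

theorem measurable_realForm (hA : IsHermitianGaussian μ A) (k : Fin m)
    (u v : EuclideanSpace ℂ (Fin n)) : Measurable fun ω => realForm (A k ω) u v := by
  simp only [realForm_apply]
  refine Finset.measurable_sum _ fun i _ => Finset.measurable_sum _ fun j _ => ?_
  exact Complex.measurable_re.comp ((hA.measurable k i j).mul_const _)

/-- The contribution of an entry on or above the diagonal to `Re ⟨A u, v⟩`. -/
noncomputable def entryTerm (A : Fin m → Ω → Matrix (Fin n) (Fin n) ℂ)
    (u v : EuclideanSpace ℂ (Fin n)) (p : Fin m × {q : Fin n × Fin n // q.1 ≤ q.2}) (ω : Ω) : ℝ :=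
  (if p.2.1.1 = p.2.1.2 then 1 else 2) *
    (A p.1 ω p.2.1.1 p.2.1.2 * symOuter u v p.2.1.1 p.2.1.2).re

theorem measurable_entryTerm (hA : IsHermitianGaussian μ A) (u v : EuclideanSpace ℂ (Fin n))
    (p : Fin m × {q : Fin n × Fin n // q.1 ≤ q.2}) : Measurable (entryTerm A u v p) :=
  (Complex.measurable_re.comp ((hA.measurable _ _ _).mul_const _)).const_mul _

theorem realForm_eq_sum_entryTerm (hA : IsHermitianGaussian μ A) (u v : EuclideanSpace ℂ (Fin n))
    (k : Fin m) (ω : Ω) : realForm (A k ω) u v = ∑ q, entryTerm A u v (k, q) ω := by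
  rw [realForm_eq_sum_symOuter (hA.hermitian k ω)]
  refine sum_symm_eq_sum_upper fun i j => ?_
  rw [← (hA.hermitian k ω).apply, ← conj_symOuter u v j i, ← Complex.conj_re]
  simp

theorem iIndepFun_entryTerm (hA : IsHermitianGaussian μ A) (u v : EuclideanSpace ℂ (Fin n)) :
    iIndepFun (entryTerm A u v) μ :=
  hA.indep.comp (fun p z => (if p.2.1.1 = p.2.1.2 then 1 else 2) *
    (z * symOuter u v p.2.1.1 p.2.1.2).re) fun p => by fun_prop

theorem map_entryTerm (hA : IsHermitianGaussian μ A) (u v : EuclideanSpace ℂ (Fin n))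
    (p : Fin m × {q : Fin n × Fin n // q.1 ≤ q.2}) :
    μ.map (entryTerm A u v p) = gaussianReal 0
      (.mk ((if p.2.1.1 = p.2.1.2 then 1 else 2) * ‖symOuter u v p.2.1.1 p.2.1.2‖ ^ 2)
        (by split_ifs <;> positivity)) := by
  obtain ⟨k, ⟨i, j⟩, hij⟩ := p
  have hij' : i ≤ j := hij
  rcases hij'.eq_or_lt with rfl | hlt
  · have h1 : entryTerm A u v (k, ⟨(i, i), hij⟩) =
        (fun z : ℂ => (z * symOuter u v i i).re) ∘ fun ω => A k ω i i := by
      ext ω; simp [entryTerm]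
    rw [h1, ← Measure.map_map (by fun_prop) (hA.measurable k i i), hA.law_diag,
      map_ofReal_mul_re]
    congr 1
    rw [← NNReal.coe_inj]
    have him : (symOuter u v i i).im = 0 := Complex.conj_eq_iff_im.1 (conj_symOuter u v i i)
    have hre : ‖symOuter u v i i‖ ^ 2 = (symOuter u v i i).re ^ 2 := by
      rw [Complex.sq_norm, Complex.normSq_apply, him]
      ring
    simp [hre]
  · have h1 : entryTerm A u v (k, ⟨(i, j), hij⟩) =
        (fun z : ℂ => 2 * (z * symOuter u v i j).re) ∘ fun ω => A k ω i j := by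
      ext ω; simp [entryTerm, hlt.ne]
    rw [h1, ← Measure.map_map (by fun_prop) (hA.measurable k i j), hA.law_upper k i j hlt,
      map_complexGaussian_mul_re]
    congr 1
    rw [← NNReal.coe_inj]
    simp [hlt.ne]

/-- The weights `1` on and `2` above the diagonal are those with which the entries occur in the full
Frobenius norm, so the variances add up to `symOuterSq u v`. -/
theorem map_realForm (hA : IsHermitianGaussian μ A) (k : Fin m) (u v : EuclideanSpace ℂ (Fin n)) :
    μ.map (fun ω => realForm (A k ω) u v) =
      gaussianReal 0 (.mk (symOuterSq u v) (symOuterSq_nonneg u v)) := by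
  simp only [realForm_eq_sum_entryTerm hA]
  rw [map_sum_eq_gaussianReal (fun q => measurable_entryTerm hA u v (k, q))
    ((iIndepFun_entryTerm hA u v).precomp (g := fun q => (k, q)) (Prod.mk_right_injective k))
    (fun q => map_entryTerm hA u v (k, q))]
  congr 1
  rw [← NNReal.coe_inj, NNReal.coe_sum]
  simp only [NNReal.coe_mk]
  rw [← sum_norm_symOuter_sq, sum_symm_eq_sum_upper]
  intro i j
  rw [← conj_symOuter, RCLike.norm_conj]

theorem iIndepFun_realForm (hA : IsHermitianGaussian μ A) (u v : EuclideanSpace ℂ (Fin n)) :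
    iIndepFun (fun k ω => realForm (A k ω) u v) μ := by
  simp only [realForm_eq_sum_entryTerm hA]
  exact iIndepFun_row_sums (measurable_entryTerm hA u v) (iIndepFun_entryTerm hA u v)

theorem measure_mean_sub_symOuterSq_gt_le (hA : IsHermitianGaussian μ A) (hm : 0 < m)
    {u v : EuclideanSpace ℂ (Fin n)} (hu : ‖u‖ = 1) (hv : ‖v‖ = 1) {t : ℝ} (ht0 : 0 ≤ t)
    (ht : t ≤ 1 / 2) :
    μ.real {ω | t < |(1 / (m : ℝ)) * ∑ k, realForm (A k ω) u v ^ 2 - symOuterSq u v|} ≤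
      2 * Real.exp (-(m * t ^ 2 / 8)) := by
  have := (iIndepFun_realForm hA u v).isProbabilityMeasure
  have h := measure_abs_sum_sq_sub_ge_le (v := .mk (symOuterSq u v) (symOuterSq_nonneg u v))
    (by rw [← NNReal.coe_le_coe]; simpa [hu, hv] using symOuterSq_le u v)
    (fun k => measurable_realForm hA k u v)
    (iIndepFun_realForm hA u v) (fun k => map_realForm hA k u v) ht0 ht
  rw [Fintype.card_fin] at h
  refine (measureReal_mono fun ω hω => ?_).trans h
  have hm' : (0 : ℝ) < m := by exact_mod_cast hm
  have hω' : t < |(1 / (m : ℝ)) * ∑ k, realForm (A k ω) u v ^ 2 - symOuterSq u v| := hω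
  have e : ∑ k, (realForm (A k ω) u v ^ 2 - symOuterSq u v) =
      m * ((1 / (m : ℝ)) * ∑ k, realForm (A k ω) u v ^ 2 - symOuterSq u v) := by
    rw [Finset.sum_sub_distrib]
    simp
    field_simp
  change (m : ℝ) * t ≤ |∑ k, (realForm (A k ω) u v ^ 2 - symOuterSq u v)|
  rw [e, abs_mul, abs_of_pos hm']
  exact mul_le_mul_of_nonneg_left hω'.le hm'.le

/-- Gaussian measurements satisfy a restricted isometry property on the matrices
`(u v* + v u*) / 2`. -/
theorem exists_restricted_isometry {ξ : ℝ} (hξ0 : 0 < ξ) (hξ1 : ξ < 1) {t : ℝ} (ht0 : 0 < t)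
    (ht : t ≤ 1 / 2) (hnm : 8 * Real.log (1250 / ξ) / t ^ 2 * n < m) [IsProbabilityMeasure μ]
    (hA : IsHermitianGaussian μ A) :
    ∃ S : Set Ω, MeasurableSet S ∧ ENNReal.ofReal (1 - ξ) ≤ μ S ∧
      ∀ ω ∈ S, ∀ u v : EuclideanSpace ℂ (Fin n),
        |(1 / (m : ℝ)) * ∑ k, realForm (A k ω) u v ^ 2 - symOuterSq u v| ≤
          1024 * t * (‖u‖ ^ 2 * ‖v‖ ^ 2) := by
  -- Dimension `0` is separate because the union bound ends with `(ξ / 2) ^ n ≤ ξ / 2`.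
  rcases Nat.eq_zero_or_pos n with rfl | hn
  · refine ⟨Set.univ, MeasurableSet.univ, ?_, fun ω _ u v => ?_⟩
    · rw [measure_univ]
      exact ENNReal.ofReal_le_one.2 (by linarith)
    · rw [Subsingleton.elim u 0]
      simp [symOuterSq]
  obtain ⟨N, hcard, hN1, hN⟩ := exists_half_net_sphere (EuclideanSpace ℂ (Fin n))
  have hfin : Module.finrank ℝ (EuclideanSpace ℂ (Fin n)) = 2 * n := by
    rw [← Module.finrank_mul_finrank ℝ ℂ, Complex.finrank_real_complex, finrank_euclideanSpace_fin]
  rw [hfin] at hcard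
  have hlog : 0 < Real.log (1250 / ξ) := Real.log_pos (by rw [lt_div_iff₀ hξ0]; linarith)
  have hm : 0 < m := by
    have : (0 : ℝ) < m := lt_of_le_of_lt (by positivity) hnm
    exact_mod_cast this
  let bad : EuclideanSpace ℂ (Fin n) × EuclideanSpace ℂ (Fin n) → Set Ω := fun p =>
    {ω | t < |(1 / (m : ℝ)) * ∑ k, realForm (A k ω) p.1 p.2 ^ 2 - symOuterSq p.1 p.2|}
  have hbad : ∀ p, MeasurableSet (bad p) := by
    intro p
    refine measurableSet_lt measurable_const ?_
    have : ∀ k, Measurable fun ω => realForm (A k ω) p.1 p.2 := fun k =>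
      measurable_realForm hA k p.1 p.2
    fun_prop
  have hU : MeasurableSet (⋃ p ∈ N ×ˢ N, bad p) := Finset.measurableSet_biUnion _ fun p _ => hbad p
  have hprob : μ.real (⋃ p ∈ N ×ˢ N, bad p) ≤ ξ := by
    -- There are at most `625 ^ n` pairs and each fails with probability at most `2 * (ξ / 1250) ^
    -- n`; the total is `2 * (ξ / 2) ^ n`.
    have hexp : Real.exp (-(m * t ^ 2 / 8)) ≤ (ξ / 1250) ^ n := by
      have : (ξ / 1250) ^ n = Real.exp (-(n * Real.log (1250 / ξ))) := by
        rw [← inv_div, inv_pow, Real.exp_neg, Real.exp_nat_mul, Real.exp_log (by positivity)]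
      rw [this]
      refine Real.exp_le_exp.2 (neg_le_neg ?_)
      have h := hnm.le
      rw [div_mul_eq_mul_div, div_le_iff₀ (by positivity)] at h
      linarith
    calc μ.real (⋃ p ∈ N ×ˢ N, bad p) ≤ ∑ p ∈ N ×ˢ N, μ.real (bad p) :=
          measureReal_biUnion_finset_le _ _
      _ ≤ ∑ p ∈ N ×ˢ N, 2 * Real.exp (-(m * t ^ 2 / 8)) := by
          refine Finset.sum_le_sum fun p hp => ?_
          rw [Finset.mem_product] at hp
          exact measure_mean_sub_symOuterSq_gt_le hA hm (hN1 _ hp.1) (hN1 _ hp.2) ht0.le ht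
      _ = (N.card : ℝ) ^ 2 * (2 * Real.exp (-(m * t ^ 2 / 8))) := by
          rw [Finset.sum_const, Finset.card_product, nsmul_eq_mul]
          push_cast
          ring
      _ ≤ ((5 : ℝ) ^ (2 * n)) ^ 2 * (2 * (ξ / 1250) ^ n) := by
          gcongr
          exact_mod_cast hcard
      _ = 2 * (ξ / 2) ^ n := by
          rw [← pow_mul, mul_right_comm, mul_left_comm, pow_mul, ← mul_pow]
          congr 2
          ring
      _ ≤ 2 * (ξ / 2) ^ 1 := by
          have : (ξ / 2) ^ n ≤ (ξ / 2) ^ 1 :=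
            pow_le_pow_of_le_one (by positivity) (by linarith) hn
          linarith
      _ = ξ := by ring
  refine ⟨(⋃ p ∈ N ×ˢ N, bad p)ᶜ, hU.compl, ?_, fun ω hω u v => ?_⟩
  · rw [← ofReal_measureReal, probReal_compl_eq_one_sub hU]
    exact ENNReal.ofReal_le_ofReal (by linarith)
  · refine abs_mean_sub_symOuterSq_le_of_net (fun k => realForm_comm (hA.hermitian k ω)) hN1 hN
      (fun a ha d hd => ?_) u v
    by_contra! hcon
    exact hω (Set.mem_iUnion₂.2 ⟨(a, d), Finset.mem_product.2 ⟨ha, hd⟩, hcon⟩)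

end GaussianMeasurements

/-! ### The landscape of the loss under restricted isometry. -/

section Landscape

variable {n m : ℕ}

theorem l2Loss_eq_quadLoss {A : Fin m → Matrix (Fin n) (Fin n) ℂ} (hA : ∀ k, (A k).IsHermitian)
    (z : EuclideanSpace ℂ (Fin n)) :
    l2Loss A (fun k => quadForm (A k) z) = quadLoss (1 / (m : ℝ)) (fun k => realForm (A k))
      fun k => realForm (A k) z z := by
  ext x
  simp only [l2Loss, quadLoss, quadForm_eq_realForm (hA _), ← Complex.ofReal_sub,
    Complex.norm_real, Real.norm_eq_abs, sq_abs]

theorem realForm_smul_self {A : Matrix (Fin n) (Fin n) ℂ} {c : ℂ} (hc : ‖c‖ = 1)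
    (z : EuclideanSpace ℂ (Fin n)) : realForm A (c • z) (c • z) = realForm A z z := by
  have h : c * conj c = 1 := by rw [Complex.mul_conj, Complex.normSq_eq_norm_sq, hc]; simp
  rw [realForm_apply, realForm_apply]
  refine Finset.sum_congr rfl fun i _ => Finset.sum_congr rfl fun j _ => ?_
  congr 2
  simp only [PiLp.smul_apply, smul_eq_mul, map_mul]
  linear_combination (z j * conj (z i)) * h

theorem outerDist_nonneg (x z : EuclideanSpace ℂ (Fin n)) : 0 ≤ outerDist x z := by
  rw [outerDist, Matrix.frobenius_norm_def]
  positivity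

theorem outerDist_smul_right {c : ℂ} (hc : ‖c‖ = 1) (x z : EuclideanSpace ℂ (Fin n)) :
    outerDist x (c • z) = outerDist x z := by
  have h : c * conj c = 1 := by rw [Complex.mul_conj, Complex.normSq_eq_norm_sq, hc]; simp
  have : Matrix.vecMulVec (c • z).ofLp (star (c • z).ofLp) =
      Matrix.vecMulVec z.ofLp (star z.ofLp) := by
    ext i j
    simp only [Matrix.vecMulVec_apply, WithLp.ofLp_smul, Pi.smul_apply, Pi.star_apply, smul_eq_mul,
      star_mul', RCLike.star_def]
    linear_combination (z i * conj (z j)) * h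
  rw [outerDist, outerDist, this]

theorem exists_phase_inner_eq (x z : EuclideanSpace ℂ (Fin n)) :
    ∃ c : ℂ, ‖c‖ = 1 ∧ inner ℂ x (c • z) = (‖inner ℂ x z‖ : ℂ) := by
  rcases eq_or_ne (inner ℂ x z) 0 with h | h
  · exact ⟨1, by simp, by simp [h]⟩
  · have h' : (‖inner ℂ x z‖ : ℂ) ≠ 0 := by simpa using h
    refine ⟨conj (inner ℂ x z) / ‖inner ℂ x z‖, ?_, ?_⟩
    · rw [norm_div, RCLike.norm_conj, Complex.norm_real, norm_norm, div_self (norm_ne_zero_iff.2 h)]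
    · rw [inner_smul_right, div_mul_eq_mul_div, Complex.conj_mul', pow_two, mul_div_assoc,
        div_self h', mul_one]

/-- The phase of `z` can be aligned with `x`, so that the distance `d(x, z)` is comparable to
`‖x + z‖ ‖x - z‖`. -/
theorem exists_aligned (x z : EuclideanSpace ℂ (Fin n)) :
    ∃ c : ℂ, ‖c‖ = 1 ∧ ‖x - c • z‖ ≤ ‖x + c • z‖ ∧
      outerDist x z ≤ ‖x + c • z‖ * ‖x - c • z‖ ∧
      (‖x + c • z‖ * ‖x - c • z‖) ^ 2 / 2 ≤ symOuterSq (x + c • z) (x - c • z) := by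
  obtain ⟨c, hc, hin⟩ := exists_phase_inner_eq x z
  refine ⟨c, hc, ?_, ?_, ?_⟩
  · refine abs_le_of_sq_le_sq' ?_ (norm_nonneg _) |>.2
    have hre : 0 ≤ RCLike.re (inner ℂ x (c • z)) := by rw [hin]; simp
    rw [@norm_sub_sq ℂ, @norm_add_sq ℂ]
    linarith
  · refine abs_le_of_sq_le_sq' ?_ (by positivity) |>.2
    rw [← outerDist_smul_right hc, outerDist_sq, mul_pow]
    exact symOuterSq_le _ _
  · have him : (inner ℂ (x + c • z) (x - c • z)).im = 0 := by
      have hzx : inner ℂ (c • z) x = (‖inner ℂ x z‖ : ℂ) := by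
        rw [← inner_conj_symm, hin, Complex.conj_ofReal]
      rw [inner_sub_right, inner_add_left, inner_add_left, hin, hzx, inner_self_eq_norm_sq_to_K,
        inner_self_eq_norm_sq_to_K]
      simp [← Complex.ofReal_pow]
    rw [symOuterSq, him, mul_pow]
    nlinarith [sq_nonneg (inner ℂ (x + c • z) (x - c • z)).re]

variable {b : Fin m → EuclideanSpace ℂ (Fin n) →L[ℝ] EuclideanSpace ℂ (Fin n) →L[ℝ] ℝ}

/-- Under a restricted isometry property, the direction towards the aligned `z` is one of descent
or of negative curvature. -/
theorem hessianForm_le_of_restricted_isometry (hb : ∀ k u v, b k u v = b k v u)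
    (hrip : ∀ u v : EuclideanSpace ℂ (Fin n),
      |(1 / (m : ℝ)) * ∑ k, b k u v ^ 2 - symOuterSq u v| ≤ 1 / 16 * (‖u‖ ^ 2 * ‖v‖ ^ 2))
    {cs : Fin m → ℝ} {x y : EuclideanSpace ℂ (Fin n)} (hy : ∀ k, b k y y = cs k)
    (hle : ‖x - y‖ ≤ ‖x + y‖)
    (hlow : (‖x + y‖ * ‖x - y‖) ^ 2 / 2 ≤ symOuterSq (x + y) (x - y)) :
    hessianForm (quadLoss (1 / (m : ℝ)) b cs) x (x - y) ≤
      4 * (‖gradient (quadLoss (1 / (m : ℝ)) b cs) x‖ * ‖x - y‖) -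
        (‖x + y‖ * ‖x - y‖) ^ 2 / 2 := by
  have h1 := hessianForm_sub_four_mul_fderiv (a := 1 / (m : ℝ)) hb (x := x) hy
  have h2 : fderiv ℝ (quadLoss (1 / (m : ℝ)) b cs) x (x - y) ≤
      ‖gradient (quadLoss (1 / (m : ℝ)) b cs) x‖ * ‖x - y‖ := by
    have : ‖gradient (quadLoss (1 / (m : ℝ)) b cs) x‖ =
        ‖fderiv ℝ (quadLoss (1 / (m : ℝ)) b cs) x‖ := by
      simp [gradient]
    rw [this]
    exact (Real.le_norm_self _).trans (ContinuousLinearMap.le_opNorm _ _)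
  have h3 := (abs_le.1 (hrip (x - y) (x - y))).2
  have h4 := (abs_le.1 (hrip (x + y) (x - y))).1
  have h5 := symOuterSq_le (x - y) (x - y)
  have h6 : ‖x - y‖ ^ 2 * ‖x - y‖ ^ 2 ≤ (‖x + y‖ * ‖x - y‖) ^ 2 := by
    rw [mul_pow]
    gcongr
  rw [← mul_pow ‖x + y‖] at h4
  rw [Finset.sum_sub_distrib, ← Finset.mul_sum, ← Finset.mul_sum] at h1
  have h7 : (1 / (m : ℝ)) * (2 * ∑ k, b k (x - y) (x - y) ^ 2 - 6 * ∑ k, b k (x + y) (x - y) ^ 2) =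
      2 * ((1 / (m : ℝ)) * ∑ k, b k (x - y) (x - y) ^ 2) -
        6 * ((1 / (m : ℝ)) * ∑ k, b k (x + y) (x - y) ^ 2) := by ring
  rw [h7] at h1
  -- The coefficient of `(‖x + y‖ * ‖x - y‖) ^ 2` is `2 * (1 + 1/16) - 6 * (1/2 - 1/16) = -1/2`.
  linarith

theorem hessianForm_smul {E : Type*} [NormedAddCommGroup E] [InnerProductSpace ℝ E] (f : E → ℝ)
    (x v : E) (c : ℝ) : hessianForm f x (c • v) = c ^ 2 * hessianForm f x v := by
  simp only [hessianForm, map_smul, smul_apply, smul_eq_mul]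
  ring

variable {A : Fin m → Matrix (Fin n) (Fin n) ℂ}

theorem isStrictSaddle_l2Loss (hA : ∀ k, (A k).IsHermitian)
    (hrip : ∀ u v : EuclideanSpace ℂ (Fin n),
      |(1 / (m : ℝ)) * ∑ k, realForm (A k) u v ^ 2 - symOuterSq u v| ≤
        1 / 16 * (‖u‖ ^ 2 * ‖v‖ ^ 2))
    (z : EuclideanSpace ℂ (Fin n)) :
    IsStrictSaddle (1 / 10) (1 / 10) 1 (l2Loss A fun k => quadForm (A k) z) := by
  rw [l2Loss_eq_quadLoss hA]
  have hb : ∀ k u v, realForm (A k) u v = realForm (A k) v u := fun k => realForm_comm (hA k)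
  refine ⟨contDiff_quadLoss, fun x => ?_⟩
  by_contra! hcon
  obtain ⟨hgrad, hhess, hmin⟩ := hcon
  -- The point `z` has zero loss, so it is itself a candidate in the third alternative, whose
  -- failure gives `d(x, z) > 1`.
  have hd := hmin z (isSecondOrderMin_quadLoss_of_zero (by positivity) hb fun _ => rfl)
  obtain ⟨c, hc, hle, hup, hlow⟩ := exists_aligned x z
  have h := hessianForm_le_of_restricted_isometry hb hrip
    (fun k => realForm_smul_self (A := A k) hc z) hle hlow
  set f := quadLoss (1 / (m : ℝ)) (fun k => realForm (A k)) fun k => realForm (A k) z z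
  set u := x + c • z
  set v := x - c • z
  have hD : 1 < ‖u‖ * ‖v‖ := hd.trans_le hup
  have hv0 : 0 < ‖v‖ := by
    refine (norm_nonneg v).lt_of_ne fun h0 => ?_
    rw [← h0, mul_zero] at hD
    linarith
  have hvD : ‖v‖ ^ 2 ≤ ‖u‖ * ‖v‖ := by rw [pow_two]; gcongr
  have hvD' : ‖v‖ ≤ ‖u‖ * ‖v‖ := by
    rcases le_total ‖v‖ 1 with h1 | h1
    · linarith
    · nlinarith
  have hv := hhess (‖v‖⁻¹ • v) (by rw [norm_smul, norm_inv, norm_norm, inv_mul_cancel₀ hv0.ne'])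
  rw [hessianForm_smul, inv_pow, inv_mul_eq_div, lt_div_iff₀ (by positivity)] at hv
  have hg : ‖gradient f x‖ * ‖v‖ ≤ 1 / 10 * (‖u‖ * ‖v‖) :=
    mul_le_mul hgrad.le hvD' hv0.le (by norm_num)
  -- With `D = ‖u‖ * ‖v‖`, the bounds give `-D / 10 < 4 * D / 10 - D ^ 2 / 2`, that is `D ^ 2 < D`,
  -- against `1 < D`.
  nlinarith

theorem eq_of_isSecondOrderMin_l2Loss (hA : ∀ k, (A k).IsHermitian)
    (hrip : ∀ u v : EuclideanSpace ℂ (Fin n),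
      |(1 / (m : ℝ)) * ∑ k, realForm (A k) u v ^ 2 - symOuterSq u v| ≤
        1 / 16 * (‖u‖ ^ 2 * ‖v‖ ^ 2))
    {z w : EuclideanSpace ℂ (Fin n)}
    (hw : IsLocalMin (l2Loss A fun k => quadForm (A k) z) w ∨
      IsSecondOrderMin (l2Loss A fun k => quadForm (A k) z) w) :
    outerDist w z = 0 ∧ PhaseEquiv w z := by
  rw [l2Loss_eq_quadLoss hA] at hw
  have hb : ∀ k u v, realForm (A k) u v = realForm (A k) v u := fun k => realForm_comm (hA k)
  have hw' := hw.elim (isSecondOrderMin_quadLoss_of_isLocalMin hb) id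
  obtain ⟨c, hc, hle, hup, hlow⟩ := exists_aligned w z
  have h := hessianForm_le_of_restricted_isometry hb hrip
    (fun k => realForm_smul_self (A := A k) hc z) hle hlow
  rw [hw'.1, norm_zero, zero_mul, mul_zero, zero_sub] at h
  have h0 := hw'.2 (w - c • z)
  have hD : ‖w + c • z‖ * ‖w - c • z‖ = 0 := by
    refine pow_eq_zero_iff two_ne_zero |>.1 (le_antisymm (by linarith) (sq_nonneg _))
  refine ⟨le_antisymm (hup.trans hD.le) (outerDist_nonneg w z), c, hc, ?_⟩
  rw [← sub_eq_zero, ← norm_eq_zero]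
  refine pow_eq_zero_iff two_ne_zero |>.1 (le_antisymm ?_ (sq_nonneg _))
  rw [← hD, pow_two]
  gcongr

end Landscape

/-! ### The main theorem. -/

theorem theorem2 (ξ : ℝ) (hξ₀ : 0 < ξ) (hξ₁ : ξ < 1) :
    ∃ C β ζ γ : ℝ, 0 < C ∧ 0 < β ∧ 0 < ζ ∧ 0 < γ ∧
      ∀ (n m : ℕ), C * (n : ℝ) < (m : ℝ) →
      ∀ (z : EuclideanSpace ℂ (Fin n))
        (Ω : Type*) [MeasurableSpace Ω] (μ : Measure Ω) [IsProbabilityMeasure μ]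
        (A : Fin m → Ω → Matrix (Fin n) (Fin n) ℂ), IsHermitianGaussian μ A →
      ∃ S : Set Ω, MeasurableSet S ∧ ENNReal.ofReal (1 - ξ) ≤ μ S ∧
        ∀ ω ∈ S, ∀ f : EuclideanSpace ℂ (Fin n) → ℝ,
          f = l2Loss (fun k => A k ω) (fun k => quadForm (A k ω) z) →
          IsStrictSaddle β ζ γ f ∧
          ∀ w : EuclideanSpace ℂ (Fin n), (IsLocalMin f w ∨ IsSecondOrderMin f w) →
            outerDist w z = 0 ∧ PhaseEquiv w z := by
  have hlog : 0 < Real.log (1250 / ξ) := Real.log_pos (by rw [lt_div_iff₀ hξ₀]; linarith)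
  -- The net accuracy `t = 1 / 16384` makes the isometry defect `1024 * t = 1 / 16`. Only `C`
  -- depends on `ξ`.
  refine ⟨8 * Real.log (1250 / ξ) / (1 / 16384) ^ 2, 1 / 10, 1 / 10, 1, by positivity,
    by norm_num, by norm_num, one_pos, ?_⟩
  intro n m hnm z Ω _ μ _ A hA
  obtain ⟨S, hS, hμ, hrip⟩ := exists_restricted_isometry hξ₀ hξ₁ (by norm_num) (by norm_num) hnm hA
  refine ⟨S, hS, hμ, fun ω hω f hf => ?_⟩
  subst hf
  have hherm : ∀ k, (A k ω).IsHermitian := fun k => hA.hermitian k ω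
  have hrip' : ∀ u v : EuclideanSpace ℂ (Fin n),
      |(1 / (m : ℝ)) * ∑ k, realForm (A k ω) u v ^ 2 - symOuterSq u v| ≤
        1 / 16 * (‖u‖ ^ 2 * ‖v‖ ^ 2) := fun u v =>
    (hrip ω hω u v).trans_eq (by ring)
  exact ⟨isStrictSaddle_l2Loss hherm hrip' z,
    fun w hw => eq_of_isSecondOrderMin_l2Loss hherm hrip' hw⟩
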